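/- Let $\Omega$ be a signature that contains a functional symbol (of arity $\ge 1$) and a constant symbol, and let $\mathcal C$ be the class of all (nonempty) models of $\Omega$. For $\mathfrak A,\mathfrak B\in\mathcal C$ write $\mathfrak A\sqsupseteq\mathfrak B$ if $\mathfrak A$ contains (up to isomorphism) $\mathfrak B$ as a submodel. A *(model-theoretic) language* $K$ based on $\Omega$ is a set of sentences with a satisfaction relation between models of $\Omega$ and sentences such that satisfaction is preserved under isomorphisms of models, $K$ is closed under the Boolean connectives, and $K$ includes the first-order language $L_{\omega,\omega}$ over $\Omega$. Write $L\subseteq K$ if, up to renaming of sentences, every sentence of $L$ is a sentence of $K$ with the same models. The *modal sentences* of $K$ are built from sentences of $K$ by Boolean connectives and $\Diamond$, where $\mathfrak A\vDash\Diamond\varphi$ iff $\mathfrak B\vDash\varphi$ for some $\mathfrak B\in\mathcal C$ with $\mathfrak A\sqsupseteq\mathfrak B$. The *modal theory* $\mathrm{MTh}^K(\mathcal C,\sqsupseteq)$ is the set of propositional modal formulas $\alpha(\mathsf p_1,\dots,\mathsf p_n)$ such that $\alpha(\psi_1,\dots,\psi_n)$ holds in every model in $\mathcal C$ for all modal sentences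 $\psi_1,\dots,\psi_n$ of $K$. The theory $\mathrm{MTh}^L(\mathcal C,\sqsupseteq)$ is *robust* if $\mathrm{MTh}^K(\mathcal C,\sqsupseteq)=\mathrm{MTh}^L(\mathcal C,\sqsupseteq)$ for every language $K\supseteq L$. A *normal modal logic* is a set of unimodal propositional formulas that contains all classical tautologies, $\neg\Diamond\bot$ and $\Diamond(\mathsf p\vee\mathsf q)\to\Diamond\mathsf p\vee\Diamond\mathsf q$, and is closed under Modus Ponens, substitution, and the rule $\alpha\to\beta\,/\,\Diamond\alpha\to\Diamond\beta$. $\mathrm{S4}$ is the smallest normal modal logic containing $\Diamond\Diamond\mathsf p\to\Diamond\mathsf p$ and $\mathsf p\to\Diamond\mathsf p$, and $\mathrm{S4.2.1}$ is the smallest normal modal logic that includes $\mathrm{S4}$ and contains $\Box\Diamond\mathsf p\leftrightarrow\Diamond\Box\mathsf p$. **Theorem.** The robust theory of $(\mathcal C,\sqsupseteq)$ is $\mathrm{S4.2.1}$. That is, there is a language $L$ based on $\Omega$ such that $\mathrm{MTh}^L(\mathcal C,\sqsupseteq)$ is robust and equal to $\mathrm{S4.2.1}$, and whenever $\mathrm{MTh}^L(\mathcal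 C,\sqsupseteq)$ is robust, it equals $\mathrm{S4.2.1}$. -/

import Mathlib

universe u v w t

namespace RobustModal

open scoped FirstOrder

/-! ### Propositional modal logic -/

/-- Unimodal formulas over the propositional variables `p₀, p₁, …`,
with `⊥`, `→`, `◇` as the basic connectives. -/
inductive MF : Type
  | var : ℕ → MF
  | bot : MF
  | imp : MF → MF → MF
  | dia : MF → MF

namespace MF

def neg (φ : MF) : MF := imp φ bot
def or (φ ψ : MF) : MF := imp (neg φ) ψ
def and (φ ψ : MF) : MF := neg (imp φ (neg ψ))
def iff (φ ψ : MF) : MF := and (imp φ ψ) (imp ψ φ)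
def box (φ : MF) : MF := neg (dia (neg φ))

/-- Uniform substitution of modal formulas for propositional variables. -/
def subst (σ : ℕ → MF) : MF → MF
  | var n => σ n
  | bot => bot
  | imp φ ψ => imp (subst σ φ) (subst σ ψ)
  | dia φ => dia (subst σ φ)

/-- `φ` is a classical tautology (variables and formulas `◇ψ` being treated as atoms): it is true
under every truth assignment to the formulas that respects `⊥` and `→`. -/
def IsTautology (φ : MF) : Prop :=
  ∀ e : MF → Prop, ¬ e bot → (∀ α β : MF, e (imp α β) ↔ (e α → e β)) → e φ

end MF

/-- Normal propositional unimodal logics. -/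
structure IsNormalLogic (Λ : Set MF) : Prop where
  tautology : ∀ φ : MF, φ.IsTautology → φ ∈ Λ
  dia_bot : MF.neg (MF.dia MF.bot) ∈ Λ
  dia_or : MF.imp (MF.dia (MF.or (MF.var 0) (MF.var 1)))
    (MF.or (MF.dia (MF.var 0)) (MF.dia (MF.var 1))) ∈ Λ
  modus_ponens : ∀ φ ψ : MF, φ ∈ Λ → MF.imp φ ψ ∈ Λ → ψ ∈ Λ
  substitution : ∀ (φ : MF) (σ : ℕ → MF), φ ∈ Λ → MF.subst σ φ ∈ Λ
  monotonicity : ∀ φ ψ : MF, MF.imp φ ψ ∈ Λ → MF.imp (MF.dia φ) (MF.dia ψ) ∈ Λ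

/-- The smallest normal modal logic that includes `Γ`. -/
def leastLogic (Γ : Set MF) : Set MF := ⋂₀ {Λ : Set MF | IsNormalLogic Λ ∧ Γ ⊆ Λ}

/-- `S4` is the smallest normal logic containing `◇◇p → ◇p` and `p → ◇p`. -/
def S4 : Set MF :=
  leastLogic
    {MF.imp (MF.dia (MF.dia (MF.var 0))) (MF.dia (MF.var 0)),
     MF.imp (MF.var 0) (MF.dia (MF.var 0))}

/-- `S4.2.1` is `S4 + (□◇p ↔ ◇□p)`. -/
def S421 : Set MF :=
  leastLogic
    (S4 ∪ {MF.iff (MF.box (MF.dia (MF.var 0))) (MF.dia (MF.box (MF.var 0)))})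

/-! ### Models and model-theoretic languages -/

/-- The (nonempty) models of the signature `Ω`. -/
abbrev Model (Ω : FirstOrder.Language.{u, v}) : Type (max u v (w + 1)) :=
  FirstOrder.Language.Theory.ModelType.{u, v, w} (∅ : Ω.Theory)

/-- A model-theoretic language based on the signature `Ω`: a set of sentences together with a
satisfaction relation between models of `Ω` and sentences, such that satisfaction is preserved
under isomorphisms, the sentences are closed under the classical connectives, and all sentences of
the first-order language `L_{ω,ω}` over `Ω` are included, with their usual meaning.
(The connective `⊥` is supplied by first-order logic.) -/
structure ModelLanguage (Ω : FirstOrder.Language.{u, v}) where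
  Sentence : Type t
  Sat : Model.{u, v, w} Ω → Sentence → Prop
  sat_iso : ∀ A B : Model.{u, v, w} Ω, Nonempty (A ≃[Ω] B) → ∀ φ : Sentence, Sat A φ ↔ Sat B φ
  imp : Sentence → Sentence → Sentence
  sat_imp : ∀ (A : Model.{u, v, w} Ω) (φ ψ : Sentence), Sat A (imp φ ψ) ↔ (Sat A φ → Sat A ψ)
  ofFirstOrder : Ω.Sentence → Sentence
  ofFirstOrder_injective : Function.Injective ofFirstOrder
  sat_ofFirstOrder : ∀ (A : Model.{u, v, w} Ω) (φ : Ω.Sentence),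
    Sat A (ofFirstOrder φ) ↔ FirstOrder.Language.Sentence.Realize A φ

/-- `L ⊆ K`: the sentences of `L` are, up to naming, sentences of `K` with the same meaning. -/
def ModelLanguage.IncludedIn {Ω : FirstOrder.Language.{u, v}}
    (L K : ModelLanguage.{u, v, w, t} Ω) : Prop :=
  ∃ i : L.Sentence → K.Sentence, Function.Injective i ∧
    ∀ (A : Model.{u, v, w} Ω) (φ : L.Sentence), K.Sat A (i φ) ↔ L.Sat A φ

/-- The modal sentences of a language `K`: expressions built from sentences of `K` by means of
the Boolean connectives and `◇`. -/
inductive ModalSentence {Ω : FirstOrder.Language.{u, v}} (K : ModelLanguage.{u, v, w, t} Ω) :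
    Type t
  | of : K.Sentence → ModalSentence K
  | bot : ModalSentence K
  | imp : ModalSentence K → ModalSentence K → ModalSentence K
  | dia : ModalSentence K → ModalSentence K

/-- Satisfaction of modal sentences in models, relative to a class `C` of models and a relation
`R` between models: `◇φ` holds in `A` iff `φ` holds in some `B ∈ C` with `A R B`. -/
def ModalSentence.Sat {Ω : FirstOrder.Language.{u, v}} {K : ModelLanguage.{u, v, w, t} Ω}
    (C : Set (Model.{u, v, w} Ω)) (R : Model.{u, v, w} Ω → Model.{u, v, w} Ω → Prop) :
    Model.{u, v, w} Ω → ModalSentence K → Prop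
  | A, .of ψ => K.Sat A ψ
  | _, .bot => False
  | A, .imp φ ψ => ModalSentence.Sat C R A φ → ModalSentence.Sat C R A ψ
  | A, .dia φ => ∃ B ∈ C, R A B ∧ ModalSentence.Sat C R B φ

/-- The extension of a valuation of the propositional variables by modal sentences of `K` to all
modal formulas. -/
def MF.translate {Ω : FirstOrder.Language.{u, v}} {K : ModelLanguage.{u, v, w, t} Ω}
    (val : ℕ → ModalSentence K) : MF → ModalSentence K
  | .var n => val n
  | .bot => .bot
  | .imp φ ψ => .imp (MF.translate val φ) (MF.translate val ψ)
  | .dia φ => .dia (MF.translate val φ)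

/-- The modal theory of `(C, R)` in the language `K`: the modal formulas that hold in all models
from `C` under all valuations by modal sentences of `K`, that is, the formulas valid in the modal
Lindenbaum algebra of `K` on `(C, R)`. -/
def modalTheory {Ω : FirstOrder.Language.{u, v}} (K : ModelLanguage.{u, v, w, t} Ω)
    (C : Set (Model.{u, v, w} Ω)) (R : Model.{u, v, w} Ω → Model.{u, v, w} Ω → Prop) : Set MF :=
  {φ | ∀ val : ℕ → ModalSentence K, ∀ A ∈ C, ModalSentence.Sat C R A (MF.translate val φ)}

/-- The modal theory of `(C, R)` in `L` is robust: it does not change when `L` is strengthened. -/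
def IsRobust {Ω : FirstOrder.Language.{u, v}} (L : ModelLanguage.{u, v, w, t} Ω)
    (C : Set (Model.{u, v, w} Ω)) (R : Model.{u, v, w} Ω → Model.{u, v, w} Ω → Prop) : Prop :=
  ∀ K : ModelLanguage.{u, v, w, t} Ω, L.IncludedIn K → modalTheory K C R = modalTheory L C R

/-- `Λ` is a robust theory of `(C, R)`: the modal theory of `(C, R)` in some language, and this
theory is robust. The languages range over those whose sentences form a set. -/
def IsRobustTheory {Ω : FirstOrder.Language.{u, v}}
    (C : Set (Model.{u, v, w} Ω)) (R : Model.{u, v, w} Ω → Model.{u, v, w} Ω → Prop)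
    (Λ : Set MF) : Prop :=
  ∃ L : ModelLanguage.{u, v, w, max u v w} Ω, IsRobust L C R ∧ modalTheory L C R = Λ

/-- `A ⊒ B`: the model `A` contains (an isomorphic copy of) `B` as a submodel. -/
def ContainsSubmodel {Ω : FirstOrder.Language.{u, v}} (A B : Model.{u, v, w} Ω) : Prop :=
  ∃ S : Ω.Substructure A, Nonempty (B ≃[Ω] S)

end RobustModal

/-!
Soundness: the submodel generated by the constants of `Ω` is the least submodel of every submodel
of `A`, and it has no proper submodels. At `A`, both `□◇φ` and `◇□φ` thus say that `φ` holds in it.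

Completeness: by the axioms of `S4.2.1`, above each point `Γ` of the canonical frame there is a
final point `{φ | □◇φ ∈ Γ}`, which sees only itself. The frame above `Γ` unravels into a countable
tree `Q` with a top element added. Every subset of `Q` has a supremum, and for a surjection
`e : ℕ → Q` the map `X ↦ sup {e i | i ∉ X}` is a bounded morphism from the subsets of `ℕ`, ordered
by reverse inclusion, onto `Q`. Let a function symbol act as the rotation of a disjoint union of
cycles, one of each finite length, with the constants naming the cycle of length one. A submodel is
a union of cycles, and it embeds into another one only if it is included in it, since embeddings
preserve periods; so the submodels form a copy of the power set of `ℕ`, up to isomorphism. Hence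
each formula outside of `S4.2.1` is refuted by an isomorphism-invariant valuation in the models.

Robustness: every language has an expansion by predicates for all of these valuations, and the
modal theory of the expansion is `S4.2.1`. Since modal theories shrink when the language grows, a
theory is robust exactly when it equals `S4.2.1`.
-/

namespace RobustModal

open FirstOrder FirstOrder.Language

/-! ### Formulas and Kripke semantics -/

namespace MF

/-- A numbering of the modal formulas, used for their countability. -/
def code : MF → ℕ
  | var n => Nat.pair 0 n
  | bot => Nat.pair 1 0
  | imp φ ψ => Nat.pair 2 (Nat.pair (code φ) (code ψ))
  | dia φ => Nat.pair 3 (code φ)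

theorem code_injective : Function.Injective code := by
  intro φ
  induction φ with
  | var n =>
    intro χ h
    cases χ <;> simp_all [code, Nat.pair_eq_pair]
  | bot =>
    intro χ h
    cases χ <;> simp_all [code, Nat.pair_eq_pair]
  | imp φ ψ ihφ ihψ =>
    intro χ h
    cases χ with
    | imp φ' ψ' =>
      simp only [code, Nat.pair_eq_pair, true_and] at h
      rw [ihφ h.1, ihψ h.2]
    | _ => simp [code, Nat.pair_eq_pair] at h
  | dia φ ih =>
    intro χ h
    cases χ with
    | dia φ' =>
      simp only [code, Nat.pair_eq_pair, true_and] at h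
      rw [ih h]
    | _ => simp [code, Nat.pair_eq_pair] at h

instance : Countable MF := code_injective.countable

/-- A truth assignment treats variables and formulas `◇ψ` as atoms; it need only respect `⊥` and
`→`. Satisfaction at a point and membership in a maximal theory are the examples of interest. -/
structure IsTruthAssignment (e : MF → Prop) : Prop where
  bot : ¬ e bot
  imp : ∀ φ ψ, e (imp φ ψ) ↔ (e φ → e ψ)

namespace IsTruthAssignment

variable {e : MF → Prop} (h : IsTruthAssignment e) (φ ψ : MF)
include h

theorem neg : e (neg φ) ↔ ¬ e φ :=
  (h.imp _ _).trans (imp_congr_right fun _ => iff_false_intro h.bot)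

theorem or : e (or φ ψ) ↔ e φ ∨ e ψ := by
  rw [MF.or, h.imp, h.neg, or_iff_not_imp_left]

theorem iff : e (iff φ ψ) ↔ (e φ ↔ e ψ) := by
  simp only [MF.iff, MF.and, h.neg, h.imp]
  tauto

end IsTruthAssignment

/-- Kripke semantics over the frame `(W, R)`; `V x n` says that the `n`-th variable is true
at `x`. -/
def Holds {W : Type*} (R : W → W → Prop) (V : W → ℕ → Prop) : W → MF → Prop
  | x, var n => V x n
  | _, bot => False
  | x, imp φ ψ => Holds R V x φ → Holds R V x ψ
  | x, dia φ => ∃ y, R x y ∧ Holds R V y φ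

/-- The modal form of the Tarski–Vaught test. -/
theorem holds_comp_iff {U W : Type*} {S : U → U → Prop} {R : W → W → Prop} {V : W → ℕ → Prop}
    {g : U → W} (hg : ∀ a b, S a b → R (g a) (g b))
    (hdia : ∀ a ψ, Holds R V (g a) (dia ψ) → ∃ b, S a b ∧ Holds R V (g b) ψ) (a : U) (φ : MF) :
    Holds S (V ∘ g) a φ ↔ Holds R V (g a) φ := by
  induction φ generalizing a with
  | var n => exact Iff.rfl
  | bot => exact Iff.rfl
  | imp α β ihα ihβ => exact imp_congr (ihα a) (ihβ a)
  | dia α ih =>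
    constructor
    · rintro ⟨b, hab, hb⟩
      exact ⟨g b, hg a b hab, (ih b).1 hb⟩
    · intro h
      obtain ⟨b, hab, hb⟩ := hdia a α h
      exact ⟨b, hab, (ih b).2 hb⟩

end MF

/-- A bisimulation between the frames `(W, R)` and `(W', R')`. Valuations are not part of the
notion: they are pushed forward along `Z`, see `IsBisimulation.holds_pushforward_iff`. -/
structure IsBisimulation {W W' : Type*} (R : W → W → Prop) (R' : W' → W' → Prop)
    (Z : W → W' → Prop) : Prop where
  forth : ∀ {x x' y}, Z x x' → R x y → ∃ y', R' x' y' ∧ Z y y'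
  back : ∀ {x x' y'}, Z x x' → R' x' y' → ∃ y, R x y ∧ Z y y'

theorem IsBisimulation.holds_pushforward_iff {W W' : Type*} {R : W → W → Prop}
    {R' : W' → W' → Prop} {Z : W → W' → Prop} (hZ : IsBisimulation R R' Z)
    (hunique : Relator.LeftUnique Z) (V : W → ℕ → Prop) {x : W} {x' : W'} (h : Z x x') (φ : MF) :
    MF.Holds R' (fun y' n => ∃ y, Z y y' ∧ V y n) x' φ ↔ MF.Holds R V x φ := by
  induction φ generalizing x x' with
  | var n =>
    refine ⟨?_, fun hV => ⟨x, h, hV⟩⟩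
    rintro ⟨y, hy, hV⟩
    exact hunique hy h ▸ hV
  | bot => exact Iff.rfl
  | imp α β ihα ihβ => exact imp_congr (ihα h) (ihβ h)
  | dia α ih =>
    constructor
    · rintro ⟨y', hxy', hα⟩
      obtain ⟨y, hxy, hy⟩ := hZ.back h hxy'
      exact ⟨y, hxy, (ih hy).1 hα⟩
    · rintro ⟨y, hxy, hα⟩
      obtain ⟨y', hxy', hy⟩ := hZ.forth h hxy
      exact ⟨y', hxy', (ih hy).2 hα⟩

/-! ### Normal logics and their maximal theories -/

theorem isNormalLogic_leastLogic (Γ : Set MF) : IsNormalLogic (leastLogic Γ) where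
  tautology φ h := fun _ hΛ => hΛ.1.tautology φ h
  dia_bot := fun _ hΛ => hΛ.1.dia_bot
  dia_or := fun _ hΛ => hΛ.1.dia_or
  modus_ponens φ ψ h₁ h₂ := fun Λ hΛ => hΛ.1.modus_ponens φ ψ (h₁ Λ hΛ) (h₂ Λ hΛ)
  substitution φ σ h := fun Λ hΛ => hΛ.1.substitution φ σ (h Λ hΛ)
  monotonicity φ ψ h := fun Λ hΛ => hΛ.1.monotonicity φ ψ (h Λ hΛ)

theorem subset_leastLogic (Γ : Set MF) : Γ ⊆ leastLogic Γ :=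
  fun _ hφ _ hΛ => hΛ.2 hφ

theorem leastLogic_subset {Γ Λ : Set MF} (hΛ : IsNormalLogic Λ) (h : Γ ⊆ Λ) :
    leastLogic Γ ⊆ Λ :=
  fun _ hφ => hφ Λ ⟨hΛ, h⟩

namespace IsNormalLogic

variable {Λ : Set MF} (hΛ : IsNormalLogic Λ)
include hΛ

theorem mem_of_isTruthAssignment {φ : MF} (h : ∀ e, MF.IsTruthAssignment e → e φ) : φ ∈ Λ :=
  hΛ.tautology φ fun e hbot himp => h e ⟨hbot, himp⟩

theorem dia_or_imp_mem (φ ψ : MF) : ((φ.or ψ).dia.imp (φ.dia.or ψ.dia)) ∈ Λ :=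
  hΛ.substitution _ (fun n => if n = 0 then φ else ψ) hΛ.dia_or

end IsNormalLogic

/-- A theory over the logic `Λ`: a set of formulas that includes `Λ` and is closed under
modus ponens, but not necessarily under substitution or monotonicity. -/
structure IsTheory (Λ T : Set MF) : Prop where
  subset : Λ ⊆ T
  mp : ∀ {φ ψ}, MF.imp φ ψ ∈ T → φ ∈ T → ψ ∈ T

/-- A maximal consistent theory over the logic `Λ`, a point of the canonical frame of `Λ`.
Maximality and consistency amount to the requirement that membership is a truth assignment. -/
@[ext]
structure MaximalTheory (Λ : Set MF) where
  carrier : Set MF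
  subset : Λ ⊆ carrier
  isTruthAssignment : MF.IsTruthAssignment (· ∈ carrier)

instance {Λ : Set MF} : Membership MF (MaximalTheory Λ) := ⟨fun Γ φ => φ ∈ Γ.carrier⟩

namespace IsTheory

variable {Λ T : Set MF}

theorem mem_of_imp (hT : IsTheory Λ T) (hΛ : IsNormalLogic Λ) {φ ψ : MF} (hφ : φ ∈ T)
    (h : ∀ e, MF.IsTruthAssignment e → e φ → e ψ) : ψ ∈ T :=
  hT.mp (hT.subset (hΛ.mem_of_isTruthAssignment fun e he => (he.imp _ _).2 (h e he))) hφ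

theorem setOf_imp_mem (hT : IsTheory Λ T) (hΛ : IsNormalLogic Λ) (α : MF) :
    IsTheory Λ {β | MF.imp α β ∈ T} where
  subset β hβ := hT.mem_of_imp hΛ (hT.subset hβ) fun e he hβ => (he.imp _ _).2 fun _ => hβ
  mp {β γ} hβγ hβ := hT.mp (hT.mem_of_imp hΛ hβγ fun e he h => by
    simp only [he.imp] at h ⊢
    exact fun hαβ hα => h hα (hαβ hα)) hβ

/-- A theory that contains exactly one of `φ` and `¬φ` for every `φ`, as a maximal theory. -/
def toMaximalTheory (hT : IsTheory Λ T) (hΛ : IsNormalLogic Λ)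
    (hneg : ∀ φ, MF.neg φ ∈ T ↔ φ ∉ T) : MaximalTheory Λ where
  carrier := T
  subset := hT.subset
  isTruthAssignment :=
    { bot := (hneg _).1 (hT.subset
        (hΛ.mem_of_isTruthAssignment fun e he => (he.neg _).2 he.bot))
      imp := fun φ ψ => by
        refine ⟨hT.mp, fun h => ?_⟩
        by_cases hφ : φ ∈ T
        · exact hT.mem_of_imp hΛ (h hφ) fun e he hψ => (he.imp _ _).2 fun _ => hψ
        · exact hT.mem_of_imp hΛ ((hneg φ).2 hφ) fun e he hφ =>
            (he.imp _ _).2 fun hφ' => absurd hφ' ((he.neg _).1 hφ) }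

theorem sUnion {c : Set (Set MF)} (hc : ∀ S ∈ c, IsTheory Λ S) (hchain : IsChain (· ⊆ ·) c)
    (hne : c.Nonempty) : IsTheory Λ (⋃₀ c) where
  subset φ hφ := hne.imp fun S hS => ⟨hS, (hc S hS).subset hφ⟩
  mp := by
    rintro φ ψ ⟨S₁, h₁, hφψ⟩ ⟨S₂, h₂, hφ⟩
    rcases hchain.total h₁ h₂ with h | h
    · exact ⟨S₂, h₂, (hc S₂ h₂).mp (h hφψ) hφ⟩
    · exact ⟨S₁, h₁, (hc S₁ h₁).mp hφψ (h hφ)⟩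

theorem neg_mem_iff_of_maximal (hΛ : IsNormalLogic Λ) {χ : MF}
    (hT : Maximal (fun S => IsTheory Λ S ∧ χ ∉ S) T) (φ : MF) : MF.neg φ ∈ T ↔ φ ∉ T := by
  obtain ⟨hTh, hχ⟩ := hT.prop
  have imp_mem (α : MF) (hα : α ∉ T) : MF.imp α χ ∈ T := by
    by_contra hn
    have hle : T ⊆ {β | MF.imp α β ∈ T} := fun β hβ =>
      hTh.mem_of_imp hΛ hβ fun e he hβ => (he.imp _ _).2 fun _ => hβ
    exact hα (hT.2 ⟨hTh.setOf_imp_mem hΛ α, hn⟩ hle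
      (hTh.subset (hΛ.mem_of_isTruthAssignment fun e he => (he.imp _ _).2 id)))
  constructor
  · exact fun hneg hφ => hχ (hTh.mp (hTh.mem_of_imp hΛ hneg fun e he h =>
      (he.imp _ _).2 fun hφ => absurd hφ ((he.neg _).1 h)) hφ)
  · intro hφ
    by_contra hneg
    refine hχ (hTh.mp (hTh.mem_of_imp hΛ (imp_mem φ hφ) fun e he h => ?_) (imp_mem _ hneg))
    simp only [he.imp, he.neg] at h ⊢
    exact Classical.by_cases h

theorem exists_maximalTheory (hT : IsTheory Λ T) (hΛ : IsNormalLogic Λ) {χ : MF} (hχ : χ ∉ T) :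
    ∃ Γ : MaximalTheory Λ, T ⊆ Γ.carrier ∧ χ ∉ Γ := by
  obtain ⟨M, hTM, hM⟩ := zorn_subset_nonempty {S | IsTheory Λ S ∧ χ ∉ S}
    (fun c hc hchain hne => ⟨⋃₀ c, ⟨sUnion (fun S hS => (hc hS).1) hchain hne,
      fun ⟨S, hS, h⟩ => (hc hS).2 h⟩, fun S hS => Set.subset_sUnion_of_mem hS⟩) T ⟨hT, hχ⟩
  exact ⟨hM.prop.1.toMaximalTheory hΛ (neg_mem_iff_of_maximal hΛ hM), hTM, hM.prop.2⟩

end IsTheory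

namespace MaximalTheory

variable {Λ : Set MF}

/-- The accessibility relation of the canonical frame. -/
instance : LE (MaximalTheory Λ) := ⟨fun Γ Δ => ∀ φ ∈ Δ, MF.dia φ ∈ Γ⟩

theorem imp_mem_iff (Γ : MaximalTheory Λ) {φ ψ : MF} : MF.imp φ ψ ∈ Γ ↔ (φ ∈ Γ → ψ ∈ Γ) :=
  Γ.isTruthAssignment.imp φ ψ

theorem neg_mem_iff (Γ : MaximalTheory Λ) {φ : MF} : MF.neg φ ∈ Γ ↔ φ ∉ Γ :=
  Γ.isTruthAssignment.neg φ

theorem mem_of_imp_mem (Γ : MaximalTheory Λ) {φ ψ : MF} (h : MF.imp φ ψ ∈ Λ) (hφ : φ ∈ Γ) :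
    ψ ∈ Γ :=
  Γ.imp_mem_iff.1 (Γ.subset h) hφ

theorem eq_of_subset {Γ Δ : MaximalTheory Λ} (h : Γ.carrier ⊆ Δ.carrier) : Γ = Δ := by
  refine MaximalTheory.ext (h.antisymm fun φ hφ => ?_)
  by_contra hn
  exact Δ.neg_mem_iff.1 (h (Γ.neg_mem_iff.2 hn)) hφ

theorem dia_mem_of_imp (Γ : MaximalTheory Λ) (hΛ : IsNormalLogic Λ) {φ ψ : MF}
    (h : ∀ e, MF.IsTruthAssignment e → e φ → e ψ) (hφ : MF.dia φ ∈ Γ) : MF.dia ψ ∈ Γ :=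
  Γ.mem_of_imp_mem (hΛ.monotonicity _ _
    (hΛ.mem_of_isTruthAssignment fun e he => (he.imp _ _).2 (h e he))) hφ

theorem isTheory_setOf_box_mem (Γ : MaximalTheory Λ) (hΛ : IsNormalLogic Λ) :
    IsTheory Λ {φ | MF.box φ ∈ Γ} where
  subset φ hφ := by
    have hbot : MF.dia MF.bot ∉ Γ := Γ.neg_mem_iff.1 (Γ.subset hΛ.dia_bot)
    have hneg : MF.imp (MF.neg φ) MF.bot ∈ Λ := hΛ.modus_ponens _ _ hφ
      (hΛ.mem_of_isTruthAssignment fun e he => by simp only [he.imp, he.neg]; tauto)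
    exact Γ.neg_mem_iff.2 fun hd => hbot (Γ.mem_of_imp_mem (hΛ.monotonicity _ _ hneg) hd)
  mp {φ ψ} hφψ hφ := by
    refine Γ.neg_mem_iff.2 fun hd => ?_
    have hor : MF.dia (MF.or (MF.neg (MF.imp φ ψ)) (MF.neg φ)) ∈ Γ :=
      Γ.dia_mem_of_imp hΛ (fun e he => by simp only [he.or, he.neg, he.imp]; tauto) hd
    rcases (Γ.isTruthAssignment.or _ _).1 (Γ.mem_of_imp_mem (hΛ.dia_or_imp_mem _ _) hor) with h | h
    · exact Γ.neg_mem_iff.1 hφψ h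
    · exact Γ.neg_mem_iff.1 hφ h

theorem dia_mem_iff (hΛ : IsNormalLogic Λ) {Γ : MaximalTheory Λ} {φ : MF} :
    MF.dia φ ∈ Γ ↔ ∃ Δ : MaximalTheory Λ, Γ ≤ Δ ∧ φ ∈ Δ := by
  refine ⟨fun hφ => ?_, fun ⟨_, hΔ, h⟩ => hΔ φ h⟩
  have hneg : MF.neg φ ∉ {α | MF.box α ∈ Γ} := fun hbox => Γ.neg_mem_iff.1 hbox
    (Γ.dia_mem_of_imp hΛ (fun e he => by simp only [he.neg, not_not, imp_self]) hφ)
  obtain ⟨Δ, hsub, hΔ⟩ := (Γ.isTheory_setOf_box_mem hΛ).exists_maximalTheory hΛ hneg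
  refine ⟨Δ, fun α hα => ?_, not_not.1 (mt Δ.neg_mem_iff.2 hΔ)⟩
  by_contra hd
  have hbox : MF.box (MF.neg α) ∈ Γ := Γ.neg_mem_iff.2 fun h =>
    hd (Γ.dia_mem_of_imp hΛ (fun e he => by simp only [he.neg, not_not, imp_self]) h)
  exact Δ.neg_mem_iff.1 (hsub hbox) hα

theorem box_mem_iff (hΛ : IsNormalLogic Λ) {Γ : MaximalTheory Λ} {φ : MF} :
    MF.box φ ∈ Γ ↔ ∀ Δ : MaximalTheory Λ, Γ ≤ Δ → φ ∈ Δ := by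
  rw [MF.box, Γ.neg_mem_iff, dia_mem_iff hΛ]
  simp only [neg_mem_iff, not_exists, not_and, not_not]

theorem holds_iff_mem (hΛ : IsNormalLogic Λ) (Γ : MaximalTheory Λ) (φ : MF) :
    MF.Holds (· ≤ ·) (fun Δ n => MF.var n ∈ Δ) Γ φ ↔ φ ∈ Γ := by
  induction φ generalizing Γ with
  | var n => exact Iff.rfl
  | bot => exact (iff_false_intro Γ.isTruthAssignment.bot).symm
  | imp α β ihα ihβ => exact (imp_congr (ihα Γ) (ihβ Γ)).trans Γ.imp_mem_iff.symm
  | dia α ih =>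
    exact (exists_congr fun Δ => and_congr_right fun _ => ih Δ).trans (dia_mem_iff hΛ).symm

end MaximalTheory

/-! ### The canonical frame of `S4.2.1` -/

theorem isNormalLogic_S421 : IsNormalLogic S421 := isNormalLogic_leastLogic _

theorem S4_subset_S421 : S4 ⊆ S421 :=
  Set.subset_union_left.trans (subset_leastLogic _)

theorem dia_dia_imp_mem_S421 (φ : MF) : φ.dia.dia.imp φ.dia ∈ S421 :=
  isNormalLogic_S421.substitution _ (fun _ => φ)
    (S4_subset_S421 (subset_leastLogic _ (Or.inl rfl)))

theorem imp_dia_mem_S421 (φ : MF) : φ.imp φ.dia ∈ S421 :=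
  isNormalLogic_S421.substitution _ (fun _ => φ)
    (S4_subset_S421 (subset_leastLogic _ (Or.inr rfl)))

theorem box_dia_iff_dia_box_mem_S421 (φ : MF) : φ.dia.box.iff φ.box.dia ∈ S421 :=
  isNormalLogic_S421.substitution _ (fun _ => φ) (subset_leastLogic _ (Or.inr rfl))

namespace MaximalTheory

instance : Preorder (MaximalTheory S421) where
  le_refl Γ φ hφ := Γ.mem_of_imp_mem (imp_dia_mem_S421 φ) hφ
  le_trans Γ Δ Θ h₁ h₂ φ hφ := Γ.mem_of_imp_mem (dia_dia_imp_mem_S421 φ) (h₁ _ (h₂ φ hφ))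

variable {Γ Δ : MaximalTheory S421} {φ : MF}

theorem box_dia_mem_iff_dia_box_mem : φ.dia.box ∈ Γ ↔ φ.box.dia ∈ Γ :=
  (Γ.isTruthAssignment.iff _ _).1 (Γ.subset (box_dia_iff_dia_box_mem_S421 φ))

theorem box_dia_mem_mono (h : Γ ≤ Δ) (hφ : φ.dia.box ∈ Γ) : φ.dia.box ∈ Δ := by
  rw [box_mem_iff isNormalLogic_S421] at hφ ⊢
  exact fun Θ hΘ => hφ Θ (h.trans hΘ)

theorem box_dia_mem_iff_exists : φ.dia.box ∈ Γ ↔ ∃ Δ ≥ Γ, ∀ Θ ≥ Δ, φ ∈ Θ := by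
  rw [box_dia_mem_iff_dia_box_mem, dia_mem_iff isNormalLogic_S421]
  exact exists_congr fun Δ => and_congr_right fun _ => box_mem_iff isNormalLogic_S421

theorem isTheory_setOf_box_dia_mem (Γ : MaximalTheory S421) :
    IsTheory S421 {φ | φ.dia.box ∈ Γ} where
  subset φ hφ := box_dia_mem_iff_exists.2 ⟨Γ, le_rfl, fun Θ _ => Θ.subset hφ⟩
  mp {φ ψ} hφψ hφ := by
    obtain ⟨Δ, hΓΔ, hΔ⟩ := box_dia_mem_iff_exists.1 hφψ
    obtain ⟨Θ, hΔΘ, hΘ⟩ := box_dia_mem_iff_exists.1 (box_dia_mem_mono hΓΔ hφ)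
    exact box_dia_mem_iff_exists.2 ⟨Θ, hΓΔ.trans hΔΘ, fun Ξ hΞ =>
      Ξ.imp_mem_iff.1 (hΔ Ξ (hΔΘ.trans hΞ)) (hΘ Ξ hΞ)⟩

theorem box_dia_neg_mem_iff : φ.neg.dia.box ∈ Γ ↔ φ.dia.box ∉ Γ := by
  rw [box_dia_mem_iff_exists, box_mem_iff isNormalLogic_S421]
  simp only [dia_mem_iff isNormalLogic_S421, neg_mem_iff, not_forall, not_exists, not_and,
    exists_prop, ge_iff_le]

/-- The final point above `Γ`, at which a formula is true if and only if `□◇φ` is true at `Γ`. -/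
def final (Γ : MaximalTheory S421) : MaximalTheory S421 :=
  Γ.isTheory_setOf_box_dia_mem.toMaximalTheory isNormalLogic_S421 fun _ => box_dia_neg_mem_iff

theorem mem_final_iff : φ ∈ Γ.final ↔ φ.dia.box ∈ Γ := Iff.rfl

theorem le_final_of_le (h : Γ ≤ Δ) : Δ ≤ Γ.final := fun _ hφ =>
  (box_mem_iff isNormalLogic_S421).1 (mem_final_iff.1 hφ) Δ h

theorem eq_final_of_final_le (h : Γ.final ≤ Δ) : Δ = Γ.final := by
  refine eq_of_subset fun φ hφ => mem_final_iff.2 ?_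
  have hdia : φ.dia.dia.box ∈ Γ := mem_final_iff.1 (h φ hφ)
  rw [box_mem_iff isNormalLogic_S421] at hdia ⊢
  exact fun Θ hΘ => Θ.mem_of_imp_mem (dia_dia_imp_mem_S421 φ) (hdia Θ hΘ)

end MaximalTheory

/-! ### Completeness of `S4.2.1` with respect to a power set -/

/-- The nodes of the tree of finite sequences over `ι`, ordered from the root upwards. A node is
the list of the steps that lead to it, the last one first, so that `s` lies below `t` if and only
if `s` is a suffix of `t`. -/
def Node (ι : Type*) : Type _ := List ι

namespace Node

variable {ι : Type*}

instance : PartialOrder (Node ι) where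
  le s t := List.IsSuffix s t
  le_refl _ := List.suffix_rfl
  le_trans _ _ _ := List.IsSuffix.trans
  le_antisymm _ _ h h' := h.eq_of_length_le h'.length_le

instance [Countable ι] : Countable (Node ι) := inferInstanceAs (Countable (List ι))

theorem exists_isLUB_of_le {X : Set (WithTop (Node ι))} {t : Node ι} (ht : ∀ x ∈ X, x ≤ t) :
    ∃ q, IsLUB X q := by
  induction t with
  | nil =>
    refine ⟨_, ht, fun q _ => ?_⟩
    cases q with
    | top => exact le_top
    | coe s => exact WithTop.coe_le_coe.2 List.nil_suffix
  | cons i t ih =>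
    by_cases hX : ((show Node ι from i :: t) : WithTop (Node ι)) ∈ X
    · exact ⟨_, ht, fun q hq => hq hX⟩
    · refine ih fun x hx => ?_
      obtain ⟨s, rfl, hs⟩ := WithTop.le_coe_iff.1 (ht x hx)
      refine WithTop.coe_le_coe.2 ((List.suffix_cons_iff.1 hs).resolve_left ?_)
      rintro rfl
      exact hX hx

theorem exists_isLUB (X : Set (WithTop (Node ι))) : ∃ q, IsLUB X q := by
  by_cases h : ∃ t : Node ι, ∀ x ∈ X, x ≤ t
  · exact exists_isLUB_of_le h.choose_spec
  · refine ⟨⊤, fun _ _ => le_top, fun q hq => ?_⟩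
    cases q with
    | top => exact le_rfl
    | coe t => exact absurd ⟨t, hq⟩ h

section Label

variable {W : Type*} [Preorder W] (step : ι → W → W) (x m : W)

/-- The point reached from `x` by the steps of a node; the top element is sent to `m`. -/
def label : WithTop (Node ι) → W := WithTop.recTopCoe m (List.foldr step x)

variable {step x m}

theorem label_mono (hstep : ∀ i y, y ≤ step i y) (hm : ∀ y, x ≤ y → y ≤ m) :
    Monotone (label step x m) := by
  have le_foldr (l : List ι) (y : W) : y ≤ l.foldr step y := by
    induction l with
    | nil => exact le_rfl
    | cons i l ih => exact ih.trans (hstep i _)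
  intro p q hpq
  cases q with
  | top =>
    cases p with
    | top => exact le_rfl
    | coe s => exact hm _ (le_foldr s x)
  | coe t =>
    obtain ⟨s, rfl, r, rfl⟩ := WithTop.le_coe_iff.1 hpq
    exact (le_foldr r _).trans_eq (List.foldr_append ..).symm

end Label

end Node

/-- The step `ψ` of the unravelling moves to a witness of `◇ψ`, if there is one. Indexing the steps
by formulas rather than by points keeps the tree countable. -/
theorem exists_holds_withTop_node {W : Type*} [Preorder W] (V : W → ℕ → Prop) {x m : W}
    (hm : ∀ y, x ≤ y → y ≤ m) (hfinal : ∀ y, m ≤ y → y = m) :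
    ∃ (V' : WithTop (Node MF) → ℕ → Prop) (q : WithTop (Node MF)),
      ∀ φ, MF.Holds (· ≤ ·) V' q φ ↔ MF.Holds (· ≤ ·) V x φ := by
  have hwitness (ψ : MF) (y : W) :
      ∃ z, y ≤ z ∧ (MF.Holds (· ≤ ·) V y ψ.dia → MF.Holds (· ≤ ·) V z ψ) := by
    by_cases h : MF.Holds (· ≤ ·) V y ψ.dia
    · exact h.imp fun z hz => ⟨hz.1, fun _ => hz.2⟩
    · exact ⟨y, le_rfl, fun h' => absurd h' h⟩
  choose step le_step holds_step using hwitness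
  refine ⟨V ∘ Node.label step x m, ((show Node MF from []) : WithTop (Node MF)),
    MF.holds_comp_iff (fun p q h => Node.label_mono le_step hm h) (fun q ψ hψ => ?_) _⟩
  cases q with
  | top =>
    obtain ⟨y, hy, hψ⟩ := hψ
    exact ⟨⊤, le_rfl, hfinal y hy ▸ hψ⟩
  | coe t =>
    exact ⟨((show Node MF from ψ :: t) : WithTop (Node MF)),
      WithTop.coe_le_coe.2 (List.suffix_cons ψ t), holds_step ψ _ hψ⟩

theorem isLUB_image_compl {ι Q : Type*} [Preorder Q] {e : ι → Q} (he : Function.Surjective e)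
    (q : Q) : IsLUB (e '' {i | ¬ e i ≤ q}ᶜ) q := by
  have himage : {i | ¬ e i ≤ q}ᶜ = e ⁻¹' Set.Iic q := Set.ext fun _ => not_not
  rw [himage, Set.image_preimage_eq _ he]
  exact isLUB_Iic

theorem isBisimulation_isLUB {ι Q : Type*} [Preorder Q] (hQ : ∀ S : Set Q, ∃ q, IsLUB S q)
    {e : ι → Q} (he : Function.Surjective e) :
    IsBisimulation (· ≤ ·) (· ⊇ ·) fun q (X : Set ι) => IsLUB (e '' Xᶜ) q where
  forth {q X q'} hq hqq' := by
    refine ⟨{i | ¬ e i ≤ q'}, fun i hi => ?_, isLUB_image_compl he q'⟩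
    by_contra hX
    exact hi ((hq.1 ⟨i, hX, rfl⟩).trans hqq')
  back {q X Y} hq hXY := by
    obtain ⟨q', hq'⟩ := hQ (e '' Yᶜ)
    exact ⟨q', hq.mono hq' (Set.image_mono (Set.compl_subset_compl.2 hXY)), hq'⟩

theorem exists_not_holds_set_nat {φ : MF} (hφ : φ ∉ S421) :
    ∃ (V : Set ℕ → ℕ → Prop) (X : Set ℕ), ¬ MF.Holds (· ⊇ ·) V X φ := by
  obtain ⟨Γ, -, hΓ⟩ := IsTheory.exists_maximalTheory
    ⟨subset_rfl, fun h hφ => isNormalLogic_S421.modus_ponens _ _ hφ h⟩ isNormalLogic_S421 hφ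
  obtain ⟨V, q, hV⟩ := exists_holds_withTop_node (fun Δ n => MF.var n ∈ Δ)
    (fun _ => MaximalTheory.le_final_of_le (Γ := Γ)) fun _ => MaximalTheory.eq_final_of_final_le
  obtain ⟨e, he⟩ := exists_surjective_nat (WithTop (Node MF))
  have hX := (isBisimulation_isLUB Node.exists_isLUB he).holds_pushforward_iff
    (fun _ _ _ h h' => h.unique h') V (isLUB_image_compl he q) φ
  rw [← MaximalTheory.holds_iff_mem isNormalLogic_S421, ← hV, ← hX] at hΓ
  exact ⟨_, _, hΓ⟩

/-! ### Submodels -/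

section Submodels

variable {Ω : FirstOrder.Language.{u, v}} {A B C : Model.{u, v, w} Ω}

theorem containsSubmodel_iff : ContainsSubmodel A B ↔ Nonempty (B ↪[Ω] A) :=
  ⟨fun ⟨S, ⟨e⟩⟩ => ⟨S.subtype.comp e.toEmbedding⟩, fun ⟨j⟩ => ⟨j.toHom.range, ⟨j.equivRange⟩⟩⟩

theorem containsSubmodel_refl (A : Model.{u, v, w} Ω) : ContainsSubmodel A A :=
  containsSubmodel_iff.2 ⟨Embedding.refl Ω A⟩

theorem ContainsSubmodel.trans (h₁ : ContainsSubmodel A B) (h₂ : ContainsSubmodel B C) :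
    ContainsSubmodel A C := by
  obtain ⟨i⟩ := containsSubmodel_iff.1 h₁
  obtain ⟨j⟩ := containsSubmodel_iff.1 h₂
  exact containsSubmodel_iff.2 ⟨i.comp j⟩

theorem containsSubmodel_of_equiv (e : A ≃[Ω] B) : ContainsSubmodel A B :=
  containsSubmodel_iff.2 ⟨e.symm.toEmbedding⟩

theorem ModalSentence.sat_iff_of_equiv {K : ModelLanguage.{u, v, w, t} Ω} (φ : ModalSentence K)
    (e : A ≃[Ω] B) :
    φ.Sat Set.univ ContainsSubmodel A ↔ φ.Sat Set.univ ContainsSubmodel B := by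
  induction φ with
  | of ψ => exact K.sat_iso _ _ ⟨e⟩ ψ
  | bot => exact Iff.rfl
  | imp φ ψ ihφ ihψ => exact imp_congr ihφ ihψ
  | dia φ _ =>
    exact exists_congr fun C => and_congr_right fun _ => and_congr_left fun _ =>
      ⟨(containsSubmodel_of_equiv e.symm).trans, (containsSubmodel_of_equiv e).trans⟩

variable [Nonempty Ω.Constants]

/-- The least submodel of a model, generated by the constants. -/
def leastSubmodel (A : Model.{u, v, w} Ω) : Model.{u, v, w} Ω :=
  haveI : Nonempty (⊥ : Ω.Substructure A) := nonempty_of_nonempty_constants Ω _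
  ⟨(⊥ : Ω.Substructure A)⟩

theorem ContainsSubmodel.leastSubmodel_right (h : ContainsSubmodel A B) :
    ContainsSubmodel B (leastSubmodel A) := by
  obtain ⟨S, ⟨e⟩⟩ := h
  exact containsSubmodel_iff.2
    ⟨e.symm.toEmbedding.comp (Substructure.inclusion (bot_le : ⊥ ≤ S))⟩

theorem nonempty_equiv_of_containsSubmodel_leastSubmodel
    (h : ContainsSubmodel (leastSubmodel A) B) : Nonempty (leastSubmodel A ≃[Ω] B) := by
  obtain ⟨j⟩ := containsSubmodel_iff.1 h
  let i : B ↪[Ω] A := (⊥ : Ω.Substructure A).subtype.comp j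
  have hrange : i.toHom.range = ⊥ := by
    rw [eq_bot_iff]
    rintro _ ⟨b, rfl⟩
    exact (j b).2
  have e : B ≃[Ω] i.toHom.range := i.equivRange
  rw [hrange] at e
  exact ⟨e.symm⟩

end Submodels

/-! ### Soundness of `S4.2.1` -/

section Soundness

variable {Ω : FirstOrder.Language.{u, v}} {K : ModelLanguage.{u, v, w, t} Ω}

theorem MF.translate_subst (val : ℕ → ModalSentence K) (σ : ℕ → MF) (φ : MF) :
    (φ.subst σ).translate val = φ.translate fun n => (σ n).translate val := by
  induction φ with
  | var n => rfl
  | bot => rfl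
  | imp φ ψ ihφ ihψ => exact congrArg₂ ModalSentence.imp ihφ ihψ
  | dia φ ih => exact congrArg ModalSentence.dia ih

variable {C : Set (Model.{u, v, w} Ω)} {R : Model.{u, v, w} Ω → Model.{u, v, w} Ω → Prop}

variable (K C R) in
theorem isNormalLogic_modalTheory : IsNormalLogic (modalTheory K C R) where
  tautology φ h := fun val A _ => h (fun ψ => (ψ.translate val).Sat C R A) id fun _ _ => Iff.rfl
  dia_bot := fun _ _ _ ⟨_, _, _, h⟩ => h
  dia_or := by
    rintro val A - ⟨B, hB, hAB, h⟩ hn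
    exact ⟨B, hB, hAB, h fun h₀ => hn ⟨B, hB, hAB, h₀⟩⟩
  modus_ponens φ ψ h₁ h₂ := fun val A hA => h₂ val A hA (h₁ val A hA)
  substitution φ σ h := fun val A hA => by
    rw [MF.translate_subst]
    exact h _ A hA
  monotonicity φ ψ h := fun val A _ ⟨B, hB, hAB, hφ⟩ => ⟨B, hB, hAB, h val B hB hφ⟩

theorem S4_subset_modalTheory (hrefl : ∀ A ∈ C, R A A)
    (htrans : ∀ A B D, R A B → R B D → R A D) : S4 ⊆ modalTheory K C R := by
  refine leastLogic_subset (isNormalLogic_modalTheory K C R) ?_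
  rintro _ (rfl | rfl) val A hA
  · rintro ⟨B, -, hAB, D, hD, hBD, h⟩
    exact ⟨D, hD, htrans A B D hAB hBD, h⟩
  · exact fun h => ⟨A, hA, hrefl A hA, h⟩

/-- `M` sees only points at which the same modal formulas are true as at `M`, and it is seen by all
points that are seen from `A`. The two modalities of `□◇` and of `◇□` therefore collapse at `A` to
truth at `M`. -/
structure IsFinalPointAbove (K : ModelLanguage.{u, v, w, t} Ω) (C : Set (Model.{u, v, w} Ω))
    (R : Model.{u, v, w} Ω → Model.{u, v, w} Ω → Prop) (A M : Model.{u, v, w} Ω) : Prop where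
  mem : M ∈ C
  rel : ∀ B ∈ C, R A B → R B M
  sat_iff : ∀ B ∈ C, R M B → ∀ φ : ModalSentence K, φ.Sat C R B ↔ φ.Sat C R M

namespace IsFinalPointAbove

variable {A M : Model.{u, v, w} Ω} (hM : IsFinalPointAbove K C R A M) (val : ℕ → ModalSentence K)
  (φ : MF)
include hM

theorem sat_box_dia_iff (hAM : R A M) :
    (φ.dia.box.translate val).Sat C R A ↔ (φ.translate val).Sat C R M := by
  constructor
  · intro h
    by_contra hn
    refine h ⟨M, hM.mem, hAM, ?_⟩
    rintro ⟨B, hB, hMB, h'⟩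
    exact hn ((hM.sat_iff B hB hMB _).1 h')
  · rintro h ⟨B, hB, hAB, h'⟩
    exact h' ⟨M, hM.mem, hM.rel B hB hAB, h⟩

theorem sat_dia_box_iff (hAM : R A M) :
    (φ.box.dia.translate val).Sat C R A ↔ (φ.translate val).Sat C R M := by
  constructor
  · rintro ⟨B, hB, hAB, h⟩
    by_contra hn
    exact h ⟨M, hM.mem, hM.rel B hB hAB, hn⟩
  · refine fun h => ⟨M, hM.mem, hAM, ?_⟩
    rintro ⟨B, hB, hMB, h'⟩
    exact h' ((hM.sat_iff B hB hMB _).2 h)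

end IsFinalPointAbove

theorem isTruthAssignment_sat_translate (val : ℕ → ModalSentence K) (A : Model.{u, v, w} Ω) :
    MF.IsTruthAssignment fun φ => (φ.translate val).Sat C R A where
  bot := id
  imp _ _ := Iff.rfl

theorem S421_subset_modalTheory (hrefl : ∀ A ∈ C, R A A)
    (htrans : ∀ A B D, R A B → R B D → R A D)
    (hfinal : ∀ A ∈ C, ∃ M, IsFinalPointAbove K C R A M) : S421 ⊆ modalTheory K C R := by
  refine leastLogic_subset (isNormalLogic_modalTheory K C R)
    (Set.union_subset (S4_subset_modalTheory hrefl htrans) ?_)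
  rintro _ rfl val A hA
  obtain ⟨M, hM⟩ := hfinal A hA
  have hAM : R A M := hM.rel A hA (hrefl A hA)
  exact ((isTruthAssignment_sat_translate val A).iff _ _).2
    ((hM.sat_box_dia_iff val _ hAM).trans (hM.sat_dia_box_iff val _ hAM).symm)

theorem isFinalPointAbove_leastSubmodel [Nonempty Ω.Constants] (A : Model.{u, v, w} Ω) :
    IsFinalPointAbove K Set.univ ContainsSubmodel A (leastSubmodel A) where
  mem := Set.mem_univ _
  rel _ _ h := h.leastSubmodel_right
  sat_iff _ _ h φ :=
    have ⟨e⟩ := nonempty_equiv_of_containsSubmodel_leastSubmodel h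
    (φ.sat_iff_of_equiv e).symm

variable (K) in
theorem S421_subset_modalTheory_containsSubmodel [Nonempty Ω.Constants] :
    S421 ⊆ modalTheory K Set.univ ContainsSubmodel :=
  S421_subset_modalTheory (fun A _ => containsSubmodel_refl A)
    (fun _ _ _ => ContainsSubmodel.trans) fun A _ => ⟨_, isFinalPointAbove_leastSubmodel A⟩

end Soundness

/-! ### A model whose submodels form a power set -/

/-- The disjoint union of cycles, one of each finite length; the cycle with index `n` has length
`n + 1`. The cycle with index `0`, a fixed point, serves to interpret constant symbols. -/
structure Cycles : Type w where
  index : ℕ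
  pos : ZMod (index + 1)

namespace Cycles

/-- The permutation that moves every point to its successor on its cycle. -/
def rotate (x : Cycles.{w}) : Cycles.{w} := ⟨x.index, x.pos + 1⟩

/-- The point on the cycle with index `0`. -/
def base : Cycles.{w} := ⟨0, 0⟩

theorem iterate_rotate (x : Cycles.{w}) (n : ℕ) : rotate^[n] x = ⟨x.index, x.pos + n⟩ := by
  induction n with
  | zero => rw [Nat.cast_zero, add_zero]; rfl
  | succ n ih =>
    rw [Function.iterate_succ_apply', ih, Nat.cast_succ, ← add_assoc]
    rfl

theorem isPeriodicPt_rotate_iff {x : Cycles.{w}} {n : ℕ} :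
    Function.IsPeriodicPt rotate n x ↔ x.index + 1 ∣ n := by
  rw [Function.IsPeriodicPt, Function.IsFixedPt, iterate_rotate, ← ZMod.natCast_eq_zero_iff]
  obtain ⟨i, k⟩ := x
  simp only [mk.injEq, heq_eq_eq, true_and, add_eq_left]

theorem minimalPeriod_rotate (x : Cycles.{w}) :
    Function.minimalPeriod rotate x = x.index + 1 :=
  Nat.dvd_right_iff_eq.1 fun _ => by
    rw [← Function.isPeriodicPt_iff_minimalPeriod_dvd, isPeriodicPt_rotate_iff]

end Cycles

variable {Ω : FirstOrder.Language.{u, v}}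

/-- The unary operation `x ↦ f(x, …, x)`. -/
def diag {m : ℕ} (f : Ω.Functions m) {M : Type*} [Ω.Structure M] (x : M) : M :=
  Structure.funMap f fun _ => x

theorem minimalPeriod_diag_map {m : ℕ} (f : Ω.Functions m) {M N : Type*} [Ω.Structure M]
    [Ω.Structure N] (j : M ↪[Ω] N) (x : M) :
    Function.minimalPeriod (diag f) (j x) = Function.minimalPeriod (diag f) x := by
  have hsemi : Function.Semiconj j (diag f) (diag f) := fun y => j.map_fun f fun _ => y
  rw [Function.minimalPeriod_eq_minimalPeriod_iff]
  intro n
  rw [Function.IsPeriodicPt, Function.IsFixedPt, ← hsemi.iterate_right n x, j.injective.eq_iff]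
  rfl

theorem iterate_diag_mem {m : ℕ} (f : Ω.Functions m) {M : Type*} [Ω.Structure M]
    (S : Ω.Substructure M) {x : M} (hx : x ∈ S) (n : ℕ) : (diag f)^[n] x ∈ S := by
  have hmaps : Set.MapsTo (diag f) (S : Set M) S := fun _ hy => S.fun_mem f (fun _ => _) fun _ => hy
  exact hmaps.iterate n hx

namespace Cycles

instance : Ω.Structure Cycles.{w} where
  funMap {n} _ := match n with
    | 0 => fun _ => base
    | _ + 1 => fun a => rotate (a 0)
  RelMap _ _ := False

/-- The submodel that consists of the cycles of the lengths `n + 2` for `n ∈ Y` and of `base`. -/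
def sub (Ω : FirstOrder.Language.{u, v}) (Y : Set ℕ) : Ω.Substructure Cycles.{w} where
  carrier := {x | ∀ n, x.index = n + 1 → n ∈ Y}
  fun_mem {n} _ _ ha := match n with
    | 0 => fun _ h => absurd h (Nat.zero_ne_add_one _)
    | _ + 1 => ha 0

theorem mk_mem_sub {Y : Set ℕ} {n : ℕ} {k : ZMod (n + 1 + 1)} :
    (⟨n + 1, k⟩ : Cycles.{w}) ∈ sub Ω Y ↔ n ∈ Y :=
  ⟨fun h => h n rfl, fun h _ hn => Nat.succ_injective hn ▸ h⟩

section

variable {m : ℕ} (f : Ω.Functions (m + 1))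

theorem diag_eq_rotate : (diag f : Cycles.{w} → Cycles.{w}) = rotate := rfl

include f

theorem index_map (S : Ω.Substructure Cycles.{w}) (j : S ↪[Ω] Cycles.{w}) (x : S) :
    (j x).index = x.1.index := by
  have h := (minimalPeriod_diag_map f j x).trans (minimalPeriod_diag_map f S.subtype x).symm
  rw [diag_eq_rotate, minimalPeriod_rotate, minimalPeriod_rotate] at h
  exact Nat.succ_injective h

theorem mem_of_index_eq (S : Ω.Substructure Cycles.{w}) {x y : Cycles.{w}} (hx : x ∈ S)
    (h : y.index = x.index) : y ∈ S := by
  obtain ⟨i, k⟩ := x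
  obtain ⟨_, l⟩ := y
  obtain rfl := h
  have hmem := iterate_diag_mem f S hx (l - k).val
  rwa [diag_eq_rotate, iterate_rotate, ZMod.natCast_zmod_val, add_sub_cancel] at hmem

theorem exists_eq_sub [Nonempty Ω.Constants] (S : Ω.Substructure Cycles.{w}) :
    ∃ Y, S = sub Ω Y := by
  refine ⟨{n | ∃ x ∈ S, x.index = n + 1}, SetLike.ext fun x => ⟨fun hx n hn => ⟨x, hx, hn⟩, ?_⟩⟩
  intro hx
  obtain ⟨_ | n, k⟩ := x
  · obtain ⟨c⟩ := ‹Nonempty Ω.Constants›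
    exact mem_of_index_eq f S (S.constants_mem c) rfl
  · obtain ⟨y, hy, hyn⟩ := hx n rfl
    exact mem_of_index_eq f S hy hyn.symm

end

/-- The model with universe `sub Ω Y`. -/
def model (Ω : FirstOrder.Language.{u, v}) (Y : Set ℕ) : Model.{u, v, w} Ω :=
  haveI : Nonempty (sub.{u, v, w} Ω Y) :=
    ⟨⟨base, fun _ h => absurd h (Nat.zero_ne_add_one _)⟩⟩
  ⟨sub.{u, v, w} Ω Y⟩

variable {m : ℕ} (f : Ω.Functions (m + 1)) {Y Z : Set ℕ}
include f

theorem containsSubmodel_model_iff :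
    ContainsSubmodel (model.{u, v, w} Ω Y) (model Ω Z) ↔ Z ⊆ Y := by
  rw [containsSubmodel_iff]
  constructor
  · rintro ⟨j⟩ n hn
    let x : sub.{u, v, w} Ω Z := ⟨⟨n + 1, 0⟩, mk_mem_sub.2 hn⟩
    exact (j x).2 n (index_map f _ ((sub Ω Y).subtype.comp j) x)
  · exact fun h => ⟨Substructure.inclusion fun x hx n hn => h (hx n hn)⟩

theorem subset_of_equiv (e : model.{u, v, w} Ω Y ≃[Ω] model.{u, v, w} Ω Z) : Z ⊆ Y :=
  (containsSubmodel_model_iff f).1 (containsSubmodel_of_equiv e)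

theorem exists_equiv_model_of_containsSubmodel [Nonempty Ω.Constants] {B : Model.{u, v, w} Ω}
    (h : ContainsSubmodel (model Ω Y) B) : ∃ Z ⊆ Y, Nonempty (B ≃[Ω] model.{u, v, w} Ω Z) := by
  obtain ⟨i⟩ := containsSubmodel_iff.1 h
  let j : B ↪[Ω] Cycles.{w} := (sub Ω Y).subtype.comp i
  obtain ⟨Z, hZ⟩ := exists_eq_sub f j.toHom.range
  have e : B ≃[Ω] j.toHom.range := j.equivRange
  rw [hZ] at e
  exact ⟨Z, (containsSubmodel_model_iff f).1 (h.trans (containsSubmodel_of_equiv e)), ⟨e⟩⟩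

theorem isBisimulation_model [Nonempty Ω.Constants] :
    IsBisimulation (· ⊇ ·) ContainsSubmodel fun Y (A : Model.{u, v, w} Ω) =>
      Nonempty (A ≃[Ω] model.{u, v, w} Ω Y) where
  forth := fun ⟨e⟩ hYZ => ⟨_, (containsSubmodel_of_equiv e).trans
    ((containsSubmodel_model_iff f).2 hYZ), ⟨Language.Equiv.refl Ω _⟩⟩
  back := fun ⟨e⟩ hAB =>
    exists_equiv_model_of_containsSubmodel f ((containsSubmodel_of_equiv e.symm).trans hAB)

theorem leftUnique_nonempty_equiv_model :
    Relator.LeftUnique fun Y (A : Model.{u, v, w} Ω) => Nonempty (A ≃[Ω] model.{u, v, w} Ω Y) :=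
  fun _ _ _ ⟨d⟩ ⟨e⟩ =>
    (subset_of_equiv f (d.comp e.symm)).antisymm (subset_of_equiv f (e.comp d.symm))

end Cycles


theorem exists_not_holds_containsSubmodel {m : ℕ} (f : Ω.Functions (m + 1))
    [Nonempty Ω.Constants] {φ : MF} (hφ : φ ∉ S421) :
    ∃ V : Model.{u, v, w} Ω → ℕ → Prop,
      (∀ A B : Model.{u, v, w} Ω, Nonempty (A ≃[Ω] B) → ∀ n, V A n ↔ V B n) ∧
      ∃ A, ¬ MF.Holds ContainsSubmodel V A φ := by
  obtain ⟨V, X, hX⟩ := exists_not_holds_set_nat hφ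
  rw [← (Cycles.isBisimulation_model f).holds_pushforward_iff
    (Cycles.leftUnique_nonempty_equiv_model f) V ⟨Language.Equiv.refl Ω (Cycles.model Ω X)⟩] at hX
  exact ⟨fun A n => ∃ Y, Nonempty (A ≃[Ω] Cycles.model Ω Y) ∧ V Y n,
    fun A B ⟨e⟩ n => exists_congr fun Y => and_congr_left fun _ =>
      ⟨fun ⟨d⟩ => ⟨d.comp e.symm⟩, fun ⟨d⟩ => ⟨d.comp e⟩⟩, _, hX⟩

/-! ### Languages and robustness -/

theorem ModalSentence.sat_translate_iff {K : ModelLanguage.{u, v, w, t} Ω}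
    {R : Model.{u, v, w} Ω → Model.{u, v, w} Ω → Prop} (val : ℕ → ModalSentence K)
    (A : Model.{u, v, w} Ω) (φ : MF) :
    (φ.translate val).Sat Set.univ R A ↔
      MF.Holds R (fun B n => (val n).Sat Set.univ R B) A φ := by
  induction φ generalizing A with
  | var n => exact Iff.rfl
  | bot => exact Iff.rfl
  | imp φ ψ ihφ ihψ => exact imp_congr (ihφ A) (ihψ A)
  | dia φ ih =>
    exact exists_congr fun B =>
      (and_iff_right (Set.mem_univ B)).trans (and_congr_right fun _ => ih B)

/-- The closure under implication of the sentences from `S` and of new atomic sentences indexed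
by `ι`. -/
inductive Expansion (S : Type t) (ι : Type) : Type t
  | base : S → Expansion S ι
  | atom : ι → Expansion S ι
  | imp : Expansion S ι → Expansion S ι → Expansion S ι

/-- Truth of the sentences of an expansion, for given truth values of its atoms. -/
def Expansion.Sat {S : Type t} {ι : Type} (base : S → Prop) (atom : ι → Prop) :
    Expansion S ι → Prop
  | .base φ => base φ
  | .atom i => atom i
  | .imp φ ψ => Expansion.Sat base atom φ → Expansion.Sat base atom ψ

namespace ModelLanguage

variable (L : ModelLanguage.{u, v, w, t} Ω) {ι : Type} (P : Model.{u, v, w} Ω → ι → Prop)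
  (hP : ∀ A B : Model.{u, v, w} Ω, Nonempty (A ≃[Ω] B) → ∀ i, P A i ↔ P B i)

/-- The expansion of a language by a family of isomorphism-invariant predicates of models. -/
def expand : ModelLanguage.{u, v, w, t} Ω where
  Sentence := Expansion L.Sentence ι
  Sat A := Expansion.Sat (L.Sat A) (P A)
  sat_iso A B e φ := by
    induction φ with
    | base φ => exact L.sat_iso A B e φ
    | atom i => exact hP A B e i
    | imp φ ψ ihφ ihψ => exact imp_congr ihφ ihψ
  imp := .imp
  sat_imp _ _ _ := Iff.rfl
  ofFirstOrder φ := .base (L.ofFirstOrder φ)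
  ofFirstOrder_injective _ _ h := L.ofFirstOrder_injective (Expansion.base.inj h)
  sat_ofFirstOrder := L.sat_ofFirstOrder

theorem includedIn_expand : L.IncludedIn (L.expand P hP) :=
  ⟨.base, fun _ _ => Expansion.base.inj, fun _ _ => Iff.rfl⟩

/-- The first-order language `L_{ω,ω}` over `Ω`, with its sentences lifted to the universe of the
languages over which robust theories are defined. -/
def firstOrder (Ω : FirstOrder.Language.{u, v}) : ModelLanguage.{u, v, w, max u v w} Ω where
  Sentence := ULift.{w} Ω.Sentence
  Sat A φ := Sentence.Realize A φ.down
  sat_iso _ _ := fun ⟨e⟩ φ => StrongHomClass.realize_sentence e φ.down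
  imp φ ψ := ⟨φ.down.imp ψ.down⟩
  sat_imp _ _ _ := BoundedFormula.realize_imp
  ofFirstOrder φ := ⟨φ⟩
  ofFirstOrder_injective _ _ h := ULift.up_injective h
  sat_ofFirstOrder _ _ := Iff.rfl

end ModelLanguage

/-- The renaming of the sentences of `L` that occur in a modal sentence. -/
def ModalSentence.map {L K : ModelLanguage.{u, v, w, t} Ω} (i : L.Sentence → K.Sentence) :
    ModalSentence L → ModalSentence K
  | .of ψ => .of (i ψ)
  | .bot => .bot
  | .imp φ ψ => .imp (map i φ) (map i ψ)
  | .dia φ => .dia (map i φ)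

section Antitone

variable {L K : ModelLanguage.{u, v, w, t} Ω} {i : L.Sentence → K.Sentence}
  {C : Set (Model.{u, v, w} Ω)} {R : Model.{u, v, w} Ω → Model.{u, v, w} Ω → Prop}

theorem ModalSentence.sat_map_iff (hi : ∀ A ψ, K.Sat A (i ψ) ↔ L.Sat A ψ)
    (φ : ModalSentence L) (A : Model.{u, v, w} Ω) : (φ.map i).Sat C R A ↔ φ.Sat C R A := by
  induction φ generalizing A with
  | of ψ => exact hi A ψ
  | bot => exact Iff.rfl
  | imp φ ψ ihφ ihψ => exact imp_congr (ihφ A) (ihψ A)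
  | dia φ ih =>
    exact exists_congr fun B => and_congr_right fun _ => and_congr_right fun _ => ih B

theorem MF.map_translate (val : ℕ → ModalSentence L) (φ : MF) :
    (φ.translate val).map i = φ.translate fun n => (val n).map i := by
  induction φ with
  | var n => rfl
  | bot => rfl
  | imp φ ψ ihφ ihψ => exact congrArg₂ ModalSentence.imp ihφ ihψ
  | dia φ ih => exact congrArg ModalSentence.dia ih

theorem modalTheory_anti (h : L.IncludedIn K) : modalTheory K C R ⊆ modalTheory L C R := by
  obtain ⟨i, -, hi⟩ := h
  intro φ hφ val A hA
  rw [← ModalSentence.sat_map_iff hi, MF.map_translate]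
  exact hφ _ A hA

end Antitone

section Robust

variable {m : ℕ} (f : Ω.Functions (m + 1)) [Nonempty Ω.Constants]
  (L : ModelLanguage.{u, v, w, t} Ω)
include f

theorem exists_includedIn_modalTheory_eq : ∃ K : ModelLanguage.{u, v, w, t} Ω, L.IncludedIn K ∧
    modalTheory K Set.univ ContainsSubmodel = S421 := by
  choose V hV A hA using fun φ : {φ : MF // φ ∉ S421} =>
    exists_not_holds_containsSubmodel.{u, v, w} f φ.2
  let P (A : Model.{u, v, w} Ω) (i : {φ : MF // φ ∉ S421} × ℕ) : Prop := V i.1 A i.2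
  have hP (A B : Model.{u, v, w} Ω) (e : Nonempty (A ≃[Ω] B)) (i) : P A i ↔ P B i :=
    hV i.1 A B e i.2
  refine ⟨L.expand P hP, L.includedIn_expand P hP,
    (S421_subset_modalTheory_containsSubmodel _).antisymm' fun φ hφ => ?_⟩
  by_contra hn
  let val (n : ℕ) : ModalSentence (L.expand P hP) := .of (Expansion.atom (⟨φ, hn⟩, n))
  exact hA ⟨φ, hn⟩ ((ModalSentence.sat_translate_iff val _ φ).1 (hφ val _ (Set.mem_univ _)))

theorem isRobust_iff_modalTheory_eq : IsRobust L Set.univ ContainsSubmodel ↔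
    modalTheory L Set.univ ContainsSubmodel = S421 := by
  constructor
  · intro hL
    obtain ⟨K, hLK, hK⟩ := exists_includedIn_modalTheory_eq f L
    rw [← hL K hLK, hK]
  · intro hL K hLK
    refine (modalTheory_anti hLK).antisymm ?_
    rw [hL]
    exact S421_subset_modalTheory_containsSubmodel K

end Robust

end RobustModal

theorem mainTheorem4 (Ω : FirstOrder.Language.{u, v})
    (hfun : ∃ n : ℕ, 1 ≤ n ∧ Nonempty (Ω.Functions n))
    (hconst : Nonempty Ω.Constants) :
    RobustModal.IsRobustTheory (Set.univ : Set (RobustModal.Model.{u, v, w} Ω))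
        RobustModal.ContainsSubmodel RobustModal.S421 ∧
      ∀ Λ : Set RobustModal.MF,
        RobustModal.IsRobustTheory (Set.univ : Set (RobustModal.Model.{u, v, w} Ω))
          RobustModal.ContainsSubmodel Λ → Λ = RobustModal.S421 := by
  obtain ⟨_ | m, hm, ⟨f⟩⟩ := hfun
  · exact absurd hm (Nat.not_succ_le_zero 0)
  constructor
  · obtain ⟨K, -, hK⟩ := RobustModal.exists_includedIn_modalTheory_eq f
      (RobustModal.ModelLanguage.firstOrder.{u, v, w} Ω)
    exact ⟨K, (RobustModal.isRobust_iff_modalTheory_eq f K).2 hK, hK⟩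
  · rintro Λ ⟨L, hL, rfl⟩
    exact (RobustModal.isRobust_iff_modalTheory_eq f L).1 hL
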